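/- Let $G$ be a finite graph. In the Toucher–Isolator game on $G$ two players, Toucher and Isolator, alternately claim previously unclaimed edges of $G$, Toucher moving first, until every edge has been claimed. A vertex is untouched if it is incident to no edge claimed by Toucher. Toucher aims to minimise, and Isolator to maximise, the number of vertices that are untouched at the end; let $u(G)$ be this number when both players play optimally. Let $P_n$ denote the path with $n$ edges (that is, with $n+1$ vertices). Theorem 2. For every $n\ge 2$, $u(P_n)=\left\lfloor \frac{n+4}{5}\right\rfloor$; moreover $u(P_1)=0$. -/

import Mathlib

namespace ToucherIsolator

variable {V : Type*} [Fintype V] [DecidableEq V]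

/-- The number of vertices that are incident to none of the edges in `T`. -/
def untouched (T : Finset (Sym2 V)) : ℕ :=
  (Finset.univ.filter fun v : V => ∀ e ∈ T, v ∉ e).card

mutual

/-- The final number of untouched vertices under optimal play, from the position in which Toucher
is to move, `T` is the set of edges claimed by Toucher so far, and `U` is the set of edges that
nobody has claimed yet. Toucher claims an edge of `U` so as to minimise the final number. -/
def toucherToMove (T U : Finset (Sym2 V)) : ℕ :=
  if h : U.Nonempty then
    U.attach.inf' (Finset.attach_nonempty_iff.mpr h) fun e =>
      isolatorToMove (insert e.1 T) (U.erase e.1)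
  else untouched T
termination_by U.card
decreasing_by exact Finset.card_erase_lt_of_mem e.2

/-- The final number of untouched vertices under optimal play, from the position in which Isolator
is to move, `T` is the set of edges claimed by Toucher so far, and `U` is the set of edges that
nobody has claimed yet. Isolator claims an edge of `U` so as to maximise the final number. -/
def isolatorToMove (T U : Finset (Sym2 V)) : ℕ :=
  if h : U.Nonempty then
    U.attach.sup' (Finset.attach_nonempty_iff.mpr h) fun e =>
      toucherToMove T (U.erase e.1)
  else untouched T
termination_by U.card
decreasing_by exact Finset.card_erase_lt_of_mem e.2

end

/-- `u(G)`: the number of untouched vertices at the end of the Toucher–Isolator game on `G`, in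
which the two players alternately claim unclaimed edges of `G` until all are claimed, Toucher
moving first, when both players play optimally. -/
def u (G : SimpleGraph V) [DecidableRel G.Adj] : ℕ :=
  toucherToMove ∅ G.edgeFinset

end ToucherIsolator

-- Claimed edges cut the path into segments, and only the pair `(i, k)` of each matters: `k`
-- unclaimed edges, `i` ends not bounded by Toucher, the ends of the path counting as Isolator's. A
-- claim splits `(l + r, a + 1 + b)` into `(l, a)`, `(r, b)` if Toucher makes it, and into `(l + 1,
-- a)`, `(r + 1, b)` if Isolator does. Vertices correspond to final empty segments, and the
-- untouched ones are the `(2, 0)`. Each bound comes from an additive weight on segments.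
--
-- Upper bound (`HasSegments.le_upper`): Toucher can lower the sum of `upperWeight` by a half unless
-- it is already integral and only trivial segments remain. Isolator either raises it by at most a
-- half or allows a reply next to the claimed edge that cancels the gain. Opening with an end edge
-- gives the bound.
--
-- Lower bound (`HasSegments.lower_le`): Isolator gains at least 3 fifths per move while any
-- progress is possible. Toucher destroys at most 3, except for 4 at the open end of a long `(1,
-- k)`; Isolator then either gained 4 beforehand or recovers the deficit on a segment `(1, 2)`
-- prepared in advance.

namespace ToucherIsolator

open Finset

-- One-move bounds for the game values

section Game

variable {V : Type*} [Fintype V] [DecidableEq V] {T U : Finset (Sym2 V)} {k : ℕ}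

theorem toucherToMove_empty : toucherToMove T (∅ : Finset (Sym2 V)) = untouched T := by
  rw [toucherToMove]; simp

theorem isolatorToMove_empty : isolatorToMove T (∅ : Finset (Sym2 V)) = untouched T := by
  rw [isolatorToMove]; simp

theorem toucherToMove_le {e : Sym2 V} (he : e ∈ U)
    (h : isolatorToMove (insert e T) (U.erase e) ≤ k) : toucherToMove T U ≤ k := by
  rw [toucherToMove, dif_pos ⟨e, he⟩]
  exact (Finset.inf'_le _ (mem_attach U ⟨e, he⟩)).trans h

theorem le_toucherToMove (hU : U.Nonempty)
    (h : ∀ e ∈ U, k ≤ isolatorToMove (insert e T) (U.erase e)) : k ≤ toucherToMove T U := by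
  rw [toucherToMove, dif_pos hU]
  exact Finset.le_inf' _ _ fun e _ => h e.1 e.2

theorem le_isolatorToMove {e : Sym2 V} (he : e ∈ U)
    (h : k ≤ toucherToMove T (U.erase e)) : k ≤ isolatorToMove T U := by
  rw [isolatorToMove, dif_pos ⟨e, he⟩]
  exact h.trans (Finset.le_sup' (fun e : {x // x ∈ U} => toucherToMove T (U.erase e.1))
    (mem_attach U ⟨e, he⟩))

theorem isolatorToMove_le (hU : U.Nonempty)
    (h : ∀ e ∈ U, toucherToMove T (U.erase e) ≤ k) : isolatorToMove T U ≤ k := by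
  rw [isolatorToMove, dif_pos hU]
  exact Finset.sup'_le _ _ fun e _ => h e.1 e.2

end Game

-- Runs of unclaimed indices

section Segments

/-- The pairs of consecutive members of the complement of `U` in `{0, …, n + 1}`. -/
def gaps (n : ℕ) (U : Finset ℕ) : Finset (ℕ × ℕ) :=
  (range (n + 2) ×ˢ range (n + 2)).filter fun p =>
    p.1 < p.2 ∧ p.1 ∉ U ∧ p.2 ∉ U ∧ Ioo p.1 p.2 ⊆ U

variable {n i p q : ℕ} {T T' U : Finset ℕ}

theorem mem_gaps : (p, q) ∈ gaps n U ↔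
    q < n + 2 ∧ p < q ∧ p ∉ U ∧ q ∉ U ∧ ∀ j, p < j → j < q → j ∈ U := by
  simp only [gaps, mem_filter, mem_product, mem_range, subset_iff, mem_Ioo, and_imp]
  constructor
  · rintro ⟨⟨_, h2⟩, h3, h4, h5, h6⟩
    exact ⟨h2, h3, h4, h5, fun j => @h6 j⟩
  · rintro ⟨h2, h3, h4, h5, h6⟩
    exact ⟨⟨by omega, h2⟩, h3, h4, h5, fun j => h6 j⟩

theorem exists_gap (hU : U ⊆ Icc 1 n) (hi : i ∈ U) :
    ∃ p q, (p, q) ∈ gaps n U ∧ p < i ∧ i < q := by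
  have h0 : 0 ∉ U := fun h => by have := mem_Icc.1 (hU h); omega
  have hn : n + 1 ∉ U := fun h => by have := mem_Icc.1 (hU h); omega
  have hin := mem_Icc.1 (hU hi)
  have hex : ∃ q, i < q ∧ q ∉ U := ⟨n + 1, by omega, hn⟩
  obtain ⟨p, hp, hple, hmax⟩ : ∃ p, p ∉ U ∧ p ≤ i ∧ ∀ j, p < j → j ≤ i → ¬ j ∉ U :=
    ⟨Nat.findGreatest (fun p => p ∉ U) i,
      Nat.findGreatest_spec (P := fun p => p ∉ U) (Nat.zero_le i) h0, Nat.findGreatest_le i,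
      fun _ h1 h2 => Nat.findGreatest_is_greatest h1 h2⟩
  have hpi : p ≠ i := fun h => hp (h ▸ hi)
  obtain ⟨hq1, hq2⟩ := Nat.find_spec hex
  have hqn : Nat.find hex ≤ n + 1 := Nat.find_min' hex ⟨by omega, hn⟩
  refine ⟨p, Nat.find hex, mem_gaps.2 ⟨by omega, by omega, hp, hq2, fun j hj1 hj2 => ?_⟩,
    by omega, hq1⟩
  by_contra hj
  rcases le_or_gt j i with h | h
  · exact hmax j hj1 h hj
  · exact Nat.find_min hex hj2 ⟨h, hj⟩

theorem gaps_erase (h : (p, q) ∈ gaps n U) (hp : p < i) (hq : i < q) :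
    gaps n (U.erase i) = insert (p, i) (insert (i, q) ((gaps n U).erase (p, q))) := by
  obtain ⟨h1, h2, h3, h4, h5⟩ := mem_gaps.1 h
  have hi := h5 i hp hq
  ext ⟨x, y⟩
  simp only [mem_insert, mem_erase, mem_gaps, Prod.mk.injEq, ne_eq]
  constructor
  · rintro ⟨g1, g2, g3, g4, g5⟩
    by_cases hy : y = i
    · subst hy
      left
      refine ⟨?_, rfl⟩
      by_contra hxp
      rcases lt_or_gt_of_ne hxp with hlt | hlt
      · exact h3 (g5 p hlt hp).2
      · exact g3 ⟨by omega, h5 x hlt (by omega)⟩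
    by_cases hx : x = i
    · subst hx
      right; left
      refine ⟨rfl, ?_⟩
      by_contra hyq
      rcases lt_or_gt_of_ne hyq with hlt | hlt
      · exact g4 ⟨by omega, h5 y (by omega) hlt⟩
      · exact h4 (g5 q hq hlt).2
    right; right
    refine ⟨?_, g1, g2, fun hxU => g3 ⟨hx, hxU⟩, fun hyU => g4 ⟨hy, hyU⟩,
      fun j hj1 hj2 => (g5 j hj1 hj2).2⟩
    rintro ⟨rfl, rfl⟩
    exact (g5 i hp hq).1 rfl
  · rintro (⟨rfl, rfl⟩ | ⟨rfl, rfl⟩ | ⟨hne, g1, g2, g3, g4, g5⟩)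
    · exact ⟨by omega, hp, fun hx => h3 hx.2, fun hx => hx.1 rfl,
        fun j hj1 hj2 => ⟨by omega, h5 j hj1 (by omega)⟩⟩
    · exact ⟨by omega, hq, fun hx => hx.1 rfl, fun hx => h4 hx.2,
        fun j hj1 hj2 => ⟨by omega, h5 j (by omega) hj2⟩⟩
    · refine ⟨g1, g2, fun hx => g3 hx.2, fun hx => g4 hx.2,
        fun j hj1 hj2 => ⟨?_, g5 j hj1 hj2⟩⟩
      rintro rfl
      apply hne
      constructor
      · by_contra hxp
        rcases lt_or_gt_of_ne hxp with hlt | hlt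
        · exact h3 (g5 p hlt (by omega))
        · exact g3 (h5 x hlt (by omega))
      · by_contra hyq
        rcases lt_or_gt_of_ne hyq with hlt | hlt
        · exact g4 (h5 y (by omega) hlt)
        · exact h4 (g5 q (by omega) hlt)

/-- `1` if the claimed index `p` is not Toucher's, `0` if it is. -/
def bit (T : Finset ℕ) (p : ℕ) : ℕ := if p ∈ T then 0 else 1

theorem bit_le_one : bit T p ≤ 1 := by unfold bit; split_ifs <;> omega

/-- The number of ends of a gap that are not Toucher's, and the number of indices in the gap. -/
def segment (T : Finset ℕ) (p : ℕ × ℕ) : ℕ × ℕ := (bit T p.1 + bit T p.2, p.2 - p.1 - 1)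

/-- The maximal runs of unclaimed edges (including the empty runs between consecutive claimed
edges), each given by the number of its ends that are not bounded by an edge of Toucher and by its
length. -/
def segments (n : ℕ) (T U : Finset ℕ) : Multiset (ℕ × ℕ) := (gaps n U).val.map (segment T)

/-- Membership in `T'` is left free at `i`, so both players' claims are covered. -/
theorem segments_erase (h : (p, q) ∈ gaps n U) (hp : p < i) (hq : i < q)
    (hT : ∀ j, j ≠ i → (j ∈ T' ↔ j ∈ T)) :
    segments n T U = segment T (p, q) ::ₘ ((gaps n U).erase (p, q)).val.map (segment T) ∧
    segments n T' (U.erase i) = (bit T p + bit T' i, i - p - 1) ::ₘ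
      (bit T' i + bit T q, q - i - 1) ::ₘ ((gaps n U).erase (p, q)).val.map (segment T) := by
  obtain ⟨h1, h2, h3, h4, h5⟩ := mem_gaps.1 h
  have hi := h5 i hp hq
  have hbit : ∀ j, j ≠ i → bit T' j = bit T j := fun j hj => by simp only [bit, hT j hj]
  constructor
  · rw [segments, ← Multiset.map_cons, erase_val, Multiset.cons_erase h]
  · have hi1 : ∀ y, (i, y) ∉ gaps n U := fun y hy => (mem_gaps.1 hy).2.2.1 hi
    have hi2 : ∀ y, (y, i) ∉ gaps n U := fun y hy => (mem_gaps.1 hy).2.2.2.1 hi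
    have e1 : (i, q) ∉ (gaps n U).erase (p, q) := fun hx => hi1 _ (mem_of_mem_erase hx)
    have e2 : (p, i) ∉ insert (i, q) ((gaps n U).erase (p, q)) := by
      rw [mem_insert, not_or]
      exact ⟨fun hx => by simp at hx; omega, fun hx => hi2 _ (mem_of_mem_erase hx)⟩
    rw [segments, gaps_erase h hp hq, insert_val_of_notMem e2, insert_val_of_notMem e1,
      Multiset.map_cons, Multiset.map_cons]
    have hc : ((gaps n U).erase (p, q)).val.map (segment T') =
        ((gaps n U).erase (p, q)).val.map (segment T) := by
      refine Multiset.map_congr rfl fun x hx => ?_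
      have hx' : x ∈ gaps n U := mem_of_mem_erase hx
      have n1 : x.1 ≠ i := by
        rintro rfl; exact hi1 x.2 hx'
      have n2 : x.2 ≠ i := by
        rintro rfl; exact hi2 x.1 hx'
      simp only [segment, hbit _ n1, hbit _ n2]
    rw [hc]
    simp only [segment, hbit p (by omega), hbit q (by omega)]

end Segments

-- The path game as a game on segments

variable {n : ℕ}

/-- The edge of the path on `{0, …, n}` that joins `i - 1` and `i`. -/
def pathEdge (n i : ℕ) : Sym2 (Fin (n + 1)) := s(Fin.ofNat (n + 1) (i - 1), Fin.ofNat (n + 1) i)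

theorem mem_pathEdge {i : ℕ} (hi : i ∈ Icc 1 n) {v : Fin (n + 1)} :
    v ∈ pathEdge n i ↔ v.1 + 1 = i ∨ v.1 = i := by
  obtain ⟨h1, h2⟩ := mem_Icc.1 hi
  rw [pathEdge, Sym2.mem_iff, Fin.ext_iff, Fin.ext_iff, Fin.val_ofNat, Fin.val_ofNat,
    Nat.mod_eq_of_lt (by omega), Nat.mod_eq_of_lt (by omega)]
  omega

theorem pathEdge_of_succ {x y : Fin (n + 1)} (h : x.1 + 1 = y.1) : pathEdge n y.1 = s(x, y) := by
  have h1 : Fin.ofNat (n + 1) (y.1 - 1) = x :=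
    Fin.ext (by rw [Fin.val_ofNat, Nat.mod_eq_of_lt (by omega)]; omega)
  have h2 : Fin.ofNat (n + 1) y.1 = y :=
    Fin.ext (by rw [Fin.val_ofNat, Nat.mod_eq_of_lt (by omega)])
  rw [pathEdge, h1, h2]

theorem pathEdge_injOn : Set.InjOn (pathEdge n) (Icc 1 n : Finset ℕ) := by
  intro i hi j hj h
  have hi' := mem_Icc.1 (mem_coe.1 hi)
  have hj' := mem_Icc.1 (mem_coe.1 hj)
  have h1 : (⟨i, by omega⟩ : Fin (n + 1)) ∈ pathEdge n j :=
    h ▸ (mem_pathEdge hi).2 (Or.inr rfl)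
  have h2 : (⟨i - 1, by omega⟩ : Fin (n + 1)) ∈ pathEdge n j :=
    h ▸ (mem_pathEdge hi).2 (Or.inl (by simp; omega))
  rw [mem_pathEdge hj] at h1 h2
  simp only at h1 h2
  omega

theorem edgeFinset_pathGraph [DecidableRel (SimpleGraph.pathGraph (n + 1)).Adj] :
    (SimpleGraph.pathGraph (n + 1)).edgeFinset = (Icc 1 n).image (pathEdge n) := by
  ext e
  induction e with | _ x y
  rw [SimpleGraph.mem_edgeFinset, SimpleGraph.mem_edgeSet, SimpleGraph.pathGraph_adj, mem_image]
  constructor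
  · rintro (h | h)
    · exact ⟨y.1, mem_Icc.2 ⟨by omega, by omega⟩, pathEdge_of_succ h⟩
    · exact ⟨x.1, mem_Icc.2 ⟨by omega, by omega⟩, (pathEdge_of_succ h).trans Sym2.eq_swap⟩
  · rintro ⟨i, hi, h⟩
    have hx := (mem_pathEdge hi).1 (h ▸ Sym2.mem_mk_left x y)
    have hy := (mem_pathEdge hi).1 (h ▸ Sym2.mem_mk_right x y)
    have hne : x ≠ y := by
      rintro rfl
      have hi' := mem_Icc.1 hi
      have h1 : (⟨i, by omega⟩ : Fin (n + 1)) ∈ s(x, x) :=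
        h ▸ (mem_pathEdge hi).2 (Or.inr rfl)
      have h2 : (⟨i - 1, by omega⟩ : Fin (n + 1)) ∈ s(x, x) :=
        h ▸ (mem_pathEdge hi).2 (Or.inl (by simp; omega))
      simp only [Sym2.mem_iff, or_self] at h1 h2
      rw [← h2, Fin.ext_iff] at h1
      simp only at h1
      omega
    rw [Ne, Fin.ext_iff] at hne
    omega

/-- `M` is the multiset of segments of the position in the game on the path with `n` edges in which
`T` is the set of Toucher's edges and `U` the set of unclaimed edges. -/
def HasSegments (n : ℕ) (T U : Finset (Sym2 (Fin (n + 1)))) (M : Multiset (ℕ × ℕ)) : Prop :=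
  ∃ T' U' : Finset ℕ, T' ⊆ Icc 1 n ∧ U' ⊆ Icc 1 n ∧ Disjoint T' U' ∧
    T = T'.image (pathEdge n) ∧ U = U'.image (pathEdge n) ∧ M = segments n T' U'

theorem hasSegments_start :
    HasSegments n ∅ ((Icc 1 n).image (pathEdge n)) {(2, n)} := by
  refine ⟨∅, Icc 1 n, by simp, subset_rfl, by simp, by simp, rfl, ?_⟩
  have : gaps n (Icc 1 n) = {(0, n + 1)} := by
    ext ⟨p, q⟩
    simp only [mem_gaps, mem_Icc, mem_singleton, Prod.mk.injEq]
    constructor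
    · rintro ⟨h1, h2, h3, h4, h5⟩; omega
    · rintro ⟨rfl, rfl⟩; exact ⟨by omega, by omega, by omega, by omega, by omega⟩
  rw [segments, this]
  simp [segment, bit]

variable {T U : Finset (Sym2 (Fin (n + 1)))} {M M' : Multiset (ℕ × ℕ)}

theorem HasSegments.fst_le (h : HasSegments n T U M) : ∀ c ∈ M, c.1 ≤ 2 := by
  obtain ⟨T', U', -, -, -, -, -, rfl⟩ := h
  intro c hc
  obtain ⟨x, -, rfl⟩ := Multiset.mem_map.1 hc
  have h1 := bit_le_one (T := T') (p := x.1)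
  have h2 := bit_le_one (T := T') (p := x.2)
  simp only [segment]; omega

/-- Claiming an index inside a gap, in terms of index sets. -/
theorem HasSegments.of_gap {T' U' : Finset ℕ} {p q i : ℕ}
    (hT : T' ⊆ Icc 1 n) (hU : U' ⊆ Icc 1 n) (hd : Disjoint T' U') (h : (p, q) ∈ gaps n U')
    (hp : p < i) (hq : i < q) :
    segments n T' U' = (bit T' p + bit T' q, i - p - 1 + 1 + (q - i - 1)) ::ₘ
        ((gaps n U').erase (p, q)).val.map (segment T') ∧
      HasSegments n (insert (pathEdge n i) (T'.image (pathEdge n)))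
        ((U'.image (pathEdge n)).erase (pathEdge n i))
        ((bit T' p, i - p - 1) ::ₘ (bit T' q, q - i - 1) ::ₘ
          ((gaps n U').erase (p, q)).val.map (segment T')) ∧
      HasSegments n (T'.image (pathEdge n)) ((U'.image (pathEdge n)).erase (pathEdge n i))
        ((bit T' p + 1, i - p - 1) ::ₘ (bit T' q + 1, q - i - 1) ::ₘ
          ((gaps n U').erase (p, q)).val.map (segment T')) := by
  have hi : i ∈ U' := (mem_gaps.1 h).2.2.2.2 i hp hq
  have hiT : i ∉ T' := fun hx => (disjoint_left.1 hd) hx hi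
  have hin := hU hi
  have hUe : (U'.image (pathEdge n)).erase (pathEdge n i) = (U'.erase i).image (pathEdge n) := by
    ext e
    simp only [mem_erase, mem_image]
    constructor
    · rintro ⟨hne, j, hj, rfl⟩
      exact ⟨j, ⟨fun hji => hne (hji ▸ rfl), hj⟩, rfl⟩
    · rintro ⟨j, ⟨hji, hj⟩, rfl⟩
      exact ⟨fun he => hji (pathEdge_injOn (hU hj) hin he), j, hj, rfl⟩
  obtain ⟨e1, e2⟩ := segments_erase (T := T') (T' := insert i T') h hp hq
    (fun j hj => by simp [hj])
  obtain ⟨-, e3⟩ := segments_erase (T := T') (T' := T') h hp hq (fun j hj => Iff.rfl)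
  refine ⟨?_, ?_, ?_⟩
  · rw [e1, segment]
    congr 2
    simp only; omega
  · refine ⟨insert i T', U'.erase i, insert_subset hin hT, (erase_subset _ _).trans hU, ?_,
      (image_insert _ _ _).symm, hUe, ?_⟩
    · rw [disjoint_insert_left]
      exact ⟨by simp, hd.mono_right (erase_subset _ _)⟩
    · rw [e2]; simp [bit]
  · refine ⟨T', U'.erase i, hT, (erase_subset _ _).trans hU, hd.mono_right (erase_subset _ _),
      rfl, hUe, ?_⟩
    rw [e3]; simp [bit, hiT, add_comm]

/-- Claiming an edge splits a segment in two. -/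
theorem HasSegments.split (h : HasSegments n T U M) {e : Sym2 (Fin (n + 1))} (he : e ∈ U) :
    ∃ l r a b M', l ≤ 1 ∧ r ≤ 1 ∧ M = (l + r, a + 1 + b) ::ₘ M' ∧
      HasSegments n (insert e T) (U.erase e) ((l, a) ::ₘ (r, b) ::ₘ M') ∧
      HasSegments n T (U.erase e) ((l + 1, a) ::ₘ (r + 1, b) ::ₘ M') := by
  obtain ⟨T', U', hT, hU, hd, rfl, rfl, rfl⟩ := h
  obtain ⟨i, hi, rfl⟩ := mem_image.1 he
  obtain ⟨p, q, hpq, hp, hq⟩ := exists_gap hU hi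
  exact ⟨_, _, _, _, _, bit_le_one, bit_le_one, HasSegments.of_gap hT hU hd hpq hp hq⟩

/-- Every way of splitting a segment is available. -/
theorem HasSegments.exists_edge {l r a b : ℕ}
    (h : HasSegments n T U ((l + r, a + 1 + b) ::ₘ M')) (hl : l ≤ 1) (hr : r ≤ 1) :
    ∃ e ∈ U, HasSegments n (insert e T) (U.erase e) ((l, a) ::ₘ (r, b) ::ₘ M') ∧
      HasSegments n T (U.erase e) ((l + 1, a) ::ₘ (r + 1, b) ::ₘ M') := by
  obtain ⟨T', U', hT, hU, hd, rfl, rfl, hM⟩ := h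
  have hmem : (l + r, a + 1 + b) ∈ segments n T' U' := hM ▸ Multiset.mem_cons_self _ _
  obtain ⟨⟨p, q⟩, hpq, hs⟩ := Multiset.mem_map.1 hmem
  simp only [segment, Prod.mk.injEq] at hs
  obtain ⟨hs1, hs2⟩ := hs
  have key : ∀ i, p < i → i < q → ∃ e ∈ U'.image (pathEdge n), HasSegments n
      (insert e (T'.image (pathEdge n))) ((U'.image (pathEdge n)).erase e)
        ((bit T' p, i - p - 1) ::ₘ (bit T' q, q - i - 1) ::ₘ M') ∧
      HasSegments n (T'.image (pathEdge n)) ((U'.image (pathEdge n)).erase e)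
        ((bit T' p + 1, i - p - 1) ::ₘ (bit T' q + 1, q - i - 1) ::ₘ M') := by
    intro i hp hq
    obtain ⟨h1, h2, h3⟩ := HasSegments.of_gap hT hU hd hpq hp hq
    have hM' : M' = ((gaps n U').erase (p, q)).val.map (segment T') := by
      rw [h1, hs1, show i - p - 1 + 1 + (q - i - 1) = a + 1 + b by omega] at hM
      exact (Multiset.cons_inj_right _).1 hM
    rw [← hM'] at h2 h3
    exact ⟨_, mem_image_of_mem _ ((mem_gaps.1 hpq).2.2.2.2 i hp hq), h2, h3⟩
  have hbp := bit_le_one (T := T') (p := p)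
  have hbq := bit_le_one (T := T') (p := q)
  by_cases hlp : bit T' p = l
  -- Only the number of open ends is recorded, so the actual gap may be the mirror image; then the
  -- claim is made at the mirrored index.
  · have := key (p + a + 1) (by omega) (by omega)
    rwa [hlp, show bit T' q = r by omega, show p + a + 1 - p - 1 = a by omega,
      show q - (p + a + 1) - 1 = b by omega] at this
  · have := key (p + b + 1) (by omega) (by omega)
    rwa [show bit T' p = r by omega, show bit T' q = l by omega,
      show p + b + 1 - p - 1 = b by omega, show q - (p + b + 1) - 1 = a by omega,
      Multiset.cons_swap, Multiset.cons_swap (r + 1, b)] at this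

theorem HasSegments.snd_eq_zero (h : HasSegments n T ∅ M) : ∀ c ∈ M, c.2 = 0 := by
  rintro ⟨i, k⟩ hc
  have hi := h.fst_le _ hc
  obtain ⟨M', rfl⟩ := Multiset.exists_cons_of_mem hc
  by_contra hk
  obtain ⟨l, r, hl, hr, rfl⟩ : ∃ l r, l ≤ 1 ∧ r ≤ 1 ∧ i = l + r :=
    ⟨min i 1, i - 1, by omega, by simp only at hi; omega, by omega⟩
  obtain ⟨k, rfl⟩ := Nat.exists_eq_succ_of_ne_zero hk
  rw [show k.succ = 0 + 1 + k by omega] at h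
  obtain ⟨e, he, -⟩ := h.exists_edge hl hr
  simp at he

/-- When nothing is unclaimed, vertex `v` is the empty gap `(v, v + 1)` between its two edges, a
missing edge at an end of the path being index `0` or `n + 1`. -/
theorem HasSegments.untouched_eq (h : HasSegments n T ∅ M) : untouched T = M.count (2, 0) := by
  obtain ⟨T', U', hT, hU, hd, rfl, hU', rfl⟩ := h
  obtain rfl : U' = ∅ := by simpa using hU'.symm
  have hg : gaps n ∅ = (range (n + 1)).image fun v => (v, v + 1) := by
    ext ⟨p, q⟩
    simp only [mem_gaps, mem_image, mem_range, Prod.mk.injEq, notMem_empty, not_false_eq_true,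
      true_and, imp_false, not_lt]
    constructor
    · rintro ⟨h1, h2, h3⟩
      have := h3 (p + 1) (by omega)
      exact ⟨p, by omega, rfl, by omega⟩
    · rintro ⟨v, hv, rfl, rfl⟩
      exact ⟨by omega, by omega, fun j => by omega⟩
  rw [segments, hg, image_val_of_injOn (fun x _ y _ h => (Prod.mk.inj h).1), Multiset.map_map,
    Multiset.count_map, ← filter_val, ← card_def, untouched]
  refine card_bij (fun v _ => v.1) ?_ (fun _ _ _ _ h => Fin.ext h) ?_
  · intro v hv
    simp only [mem_filter, mem_univ, true_and, mem_image, forall_exists_index, and_imp,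
      forall_apply_eq_imp_iff₂] at hv
    have h1 : v.1 ∉ T' := fun hx => hv _ hx ((mem_pathEdge (hT hx)).2 (Or.inr rfl))
    have h2 : v.1 + 1 ∉ T' := fun hx => hv _ hx ((mem_pathEdge (hT hx)).2 (Or.inl rfl))
    simp [segment, bit, h1, h2, Nat.lt_succ_iff.1 v.2]
  · intro v hv
    simp only [mem_filter, mem_range, Function.comp_apply, segment, Prod.mk.injEq] at hv
    obtain ⟨hv1, hv2, -⟩ := hv
    have h1 : v ∉ T' := fun hx => by
      have := bit_le_one (T := T') (p := v + 1); rw [bit, if_pos hx] at hv2; omega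
    have h2 : v + 1 ∉ T' := fun hx => by
      have := bit_le_one (T := T') (p := v); rw [bit.eq_1 T' (v + 1), if_pos hx] at hv2; omega
    refine ⟨⟨v, hv1⟩, ?_, rfl⟩
    simp only [mem_filter, mem_univ, true_and, mem_image, forall_exists_index, and_imp,
      forall_apply_eq_imp_iff₂]
    intro i hi hx
    rcases (mem_pathEdge (hT hi)).1 hx with rfl | rfl
    · exact h2 hi
    · exact h1 hi

/-- Both weights vanish on `(0, 0)` and `(1, 0)`, so at the end of the game they measure the score.
-/
theorem HasSegments.sum_eq (h : HasSegments n T ∅ M) {f : ℕ × ℕ → ℕ}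
    (h0 : f (0, 0) = 0) (h1 : f (1, 0) = 0) : (M.map f).sum = f (2, 0) * untouched T := by
  rw [h.untouched_eq]
  have hfst := h.fst_le
  have hsnd := h.snd_eq_zero
  clear h
  induction M using Multiset.induction with
  | empty => simp
  | cons c M ih =>
    rw [Multiset.map_cons, Multiset.sum_cons, ih (fun d hd => hfst d (Multiset.mem_cons_of_mem hd))
      (fun d hd => hsnd d (Multiset.mem_cons_of_mem hd)), Multiset.count_cons]
    obtain ⟨i, k⟩ := c
    obtain rfl : k = 0 := hsnd (i, k) (Multiset.mem_cons_self _ _)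
    have hi : i ≤ 2 := hfst (i, 0) (Multiset.mem_cons_self _ _)
    interval_cases i
    · simp [h0]
    · simp [h1]
    · simp; ring

-- Upper bound: Toucher's strategy

section Upper

/-- The weight of a segment in the upper bound for the number of untouched vertices, counted in
halves. -/
def upperWeight (c : ℕ × ℕ) : ℕ :=
  if c.1 = 2 ∧ c.2 = 1 then 3 else if c.1 = 1 ∧ c.2 = 0 then 0 else 2 * (c.2 + 3 * c.1) / 5

theorem upperWeight_zero (k : ℕ) : upperWeight (0, k) = 2 * k / 5 := rfl

theorem upperWeight_one_zero : upperWeight (1, 0) = 0 := rfl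

theorem upperWeight_one {k : ℕ} (hk : k ≠ 0) : upperWeight (1, k) = 2 * (k + 3) / 5 := by
  simp [upperWeight, hk]

theorem upperWeight_two_one : upperWeight (2, 1) = 3 := rfl

theorem upperWeight_two {k : ℕ} (hk : k ≠ 1) : upperWeight (2, k) = 2 * (k + 6) / 5 := by
  simp [upperWeight, hk]

/-- Toucher claims the edge at an open end, leaving a weightless `(1, 0)`; with no open end, the
third edge, since `(0, 2)` is weightless. -/
theorem exists_split_upperWeight_lt {i k : ℕ} (hi : i ≤ 2) (hk : k ≠ 0) (h : i = 0 → 3 ≤ k) :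
    ∃ l r a b, l ≤ 1 ∧ r ≤ 1 ∧ i = l + r ∧ k = a + 1 + b ∧
      upperWeight (l, a) + upperWeight (r, b) + 1 ≤ upperWeight (i, k) := by
  interval_cases i
  · have := h rfl
    refine ⟨0, 0, 2, k - 3, by omega, by omega, rfl, by omega, ?_⟩
    simp only [upperWeight_zero]
    omega
  · refine ⟨1, 0, 0, k - 1, by omega, by omega, by omega, by omega, ?_⟩
    rw [upperWeight_one_zero, upperWeight_zero, upperWeight_one hk]
    omega
  · refine ⟨1, 1, 0, k - 1, by omega, by omega, by omega, by omega, ?_⟩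
    rcases eq_or_ne k 1 with rfl | hk1
    · decide
    · rw [upperWeight_one_zero, upperWeight_one (by omega), upperWeight_two hk1]
      omega

/-- The generic case of `exists_reply`, checked on residues modulo 5. -/
theorem two_mul_div_five_split (x y : ℕ) :
    2 * (x + 4) / 5 + 2 * (y + 4) / 5 ≤ 2 * (x + y + 3) / 5 + 1 ∨
    2 * x / 5 + 2 * (y + 4) / 5 ≤ 2 * (x + y + 3) / 5 ∨
    2 * y / 5 + 2 * (x + 4) / 5 ≤ 2 * (x + y + 3) / 5 := by
  obtain ⟨p, s, hs, rfl⟩ : ∃ p s, s < 5 ∧ x = 5 * p + s := ⟨x / 5, x % 5, by omega, by omega⟩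
  obtain ⟨q, t, ht, rfl⟩ : ∃ q t, t < 5 ∧ y = 5 * q + t := ⟨y / 5, y % 5, by omega, by omega⟩
  interval_cases s <;> interval_cases t <;> omega

/-- Either Isolator's claim gains at most a half, or Toucher answers with an edge adjacent to it, on
one side or the other, and the weight is back to at most its old value. -/
theorem exists_reply {l r a b : ℕ} (hl : l ≤ 1) (hr : r ≤ 1) :
    upperWeight (l + 1, a) + upperWeight (r + 1, b) ≤ upperWeight (l + r, a + 1 + b) + 1 ∨
    (a ≠ 0 ∧ upperWeight (1, 0) + upperWeight (l, a - 1) + upperWeight (r + 1, b) ≤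
      upperWeight (l + r, a + 1 + b)) ∨
    (b ≠ 0 ∧ upperWeight (1, 0) + upperWeight (r, b - 1) + upperWeight (l + 1, a) ≤
      upperWeight (l + r, a + 1 + b)) := by
  have key := two_mul_div_five_split (a - 1 + 3 * l) (b - 1 + 3 * r)
  interval_cases l <;> interval_cases r <;> rcases a with _ | _ | a <;> rcases b with _ | _ | b <;>
    simp (disch := omega) only [zero_add, add_zero, Nat.reduceAdd, add_tsub_cancel_right, tsub_self,
      upperWeight_zero, upperWeight_one_zero, upperWeight_one, upperWeight_two_one,
      upperWeight_two] at key ⊢ <;>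
    first | omega | (ring_nf at key ⊢; omega)

/-- Where Toucher may be unable to lower the weight, evenness makes the rounding in the bound for
Isolator's turn harmless. -/
theorem even_sum_upperWeight (hM : ∀ c ∈ M, c.1 ≤ 2 ∧ (c.2 ≠ 0 → c.1 = 0 ∧ c.2 ≤ 2)) :
    Even (M.map upperWeight).sum := by
  induction M using Multiset.induction with
  | empty => simp
  | cons c M ih =>
    rw [Multiset.map_cons, Multiset.sum_cons]
    refine Even.add ?_ (ih fun d hd => hM d (Multiset.mem_cons_of_mem hd))
    obtain ⟨h1, h2⟩ := hM c (Multiset.mem_cons_self _ _)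
    have : upperWeight c = 0 ∨ upperWeight c = 2 := by
      unfold upperWeight
      split_ifs <;> omega
    rcases this with h | h <;> rw [h]
    · exact Even.zero
    · exact even_two

theorem HasSegments.le_upper (h : HasSegments n T U M) :
    toucherToMove T U ≤ (M.map upperWeight).sum / 2 ∧
      isolatorToMove T U ≤ ((M.map upperWeight).sum + 1) / 2 := by
  induction hN : #U using Nat.strong_induction_on generalizing T U M with
  | _ N ih =>
  subst hN
  rcases U.eq_empty_or_nonempty with rfl | hU
  · have := h.sum_eq (f := upperWeight) rfl rfl
    rw [show upperWeight (2, 0) = 2 from rfl] at this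
    rw [toucherToMove_empty, isolatorToMove_empty, this]
    omega
  have hlt : ∀ e ∈ U, #(U.erase e) < #U := fun e he => card_erase_lt_of_mem he
  constructor
  · by_cases hex : ∃ c ∈ M, c.2 ≠ 0 ∧ (c.1 = 0 → 3 ≤ c.2)
    · obtain ⟨⟨i, k⟩, hc, hk, hik⟩ := hex
      obtain ⟨l, r, a, b, hl, hr, rfl, rfl, hw⟩ :=
        exists_split_upperWeight_lt (i := i) (k := k) (h.fst_le _ hc) hk hik
      obtain ⟨M', rfl⟩ := Multiset.exists_cons_of_mem hc
      obtain ⟨e, he, h1, -⟩ := h.exists_edge hl hr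
      refine toucherToMove_le he ((ih _ (hlt e he) h1 rfl).2.trans ?_)
      simp only [Multiset.map_cons, Multiset.sum_cons]
      omega
    · push Not at hex
      obtain ⟨e, he⟩ := hU
      obtain ⟨l, r, a, b, M', hl, hr, rfl, h1, -⟩ := h.split he
      have h0 := hex _ (Multiset.mem_cons_self _ _)
      simp only at h0
      have heven := even_sum_upperWeight (M := (l + r, a + 1 + b) ::ₘ M') fun c hc =>
        ⟨h.fst_le c hc, fun hne => ⟨(hex c hc hne).1, by have := (hex c hc hne).2; omega⟩⟩
      refine toucherToMove_le he ((ih _ (hlt e he) h1 rfl).2.trans ?_)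
      obtain ⟨rfl, rfl⟩ : l = 0 ∧ r = 0 := by omega
      have hw : upperWeight (0, a) + upperWeight (0, b) ≤ upperWeight (0 + 0, a + 1 + b) := by
        simp only [add_zero, upperWeight_zero]
        omega
      simp only [Multiset.map_cons, Multiset.sum_cons] at heven ⊢
      obtain ⟨m, hm⟩ := heven
      omega
  · refine isolatorToMove_le hU fun e he => ?_
    obtain ⟨l, r, a, b, M', hl, hr, rfl, -, h1⟩ := h.split he
    have reply : ∀ {l' a' r' b' : ℕ}, l' ≤ 1 → a' ≠ 0 →
        HasSegments n T (U.erase e) ((l' + 1, a') ::ₘ (r', b') ::ₘ M') →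
        upperWeight (1, 0) + upperWeight (l', a' - 1) + upperWeight (r', b') ≤
          upperWeight (l + r, a + 1 + b) →
        toucherToMove T (U.erase e) ≤
          ((((l + r, a + 1 + b) ::ₘ M').map upperWeight).sum + 1) / 2 := by
      intro l' a' r' b' hl' ha' h2 hw
      rw [add_comm l' 1, show a' = 0 + 1 + (a' - 1) by omega] at h2
      obtain ⟨e', he', h3, -⟩ := h2.exists_edge le_rfl hl'
      refine toucherToMove_le he' ((ih _ ((card_erase_lt_of_mem he').trans (hlt e he))
        h3 rfl).2.trans ?_)
      simp only [Multiset.map_cons, Multiset.sum_cons]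
      omega
    rcases exists_reply (a := a) (b := b) hl hr with hw | ⟨ha, hw⟩ | ⟨hb, hw⟩
    · refine (ih _ (hlt e he) h1 rfl).1.trans ?_
      simp only [Multiset.map_cons, Multiset.sum_cons]
      omega
    · exact reply hl ha h1 hw
    · exact reply hr hb (Multiset.cons_swap _ _ _ ▸ h1) hw

end Upper

-- Lower bound: Isolator's strategy

section Lower

/-- The weight of a segment in the lower bound for the number of untouched vertices, counted in
fifths. -/
def lowerWeight (c : ℕ × ℕ) : ℕ :=
  if c.1 = 0 then c.2 - 2 else if c.1 = 1 then (if c.2 = 0 then 0 else c.2 + 1) else 5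

theorem lowerWeight_zero (k : ℕ) : lowerWeight (0, k) = k - 2 := rfl

theorem lowerWeight_one_zero : lowerWeight (1, 0) = 0 := rfl

theorem lowerWeight_one {k : ℕ} (hk : k ≠ 0) : lowerWeight (1, k) = k + 1 := by
  simp [lowerWeight, hk]

theorem lowerWeight_two (k : ℕ) : lowerWeight (2, k) = 5 := rfl

theorem lowerWeight_split_left (a b : ℕ) :
    lowerWeight (1, a + 1 + b) ≤ lowerWeight (1, a) + lowerWeight (0, b) + 3 ∨
    a = 0 ∧ 2 ≤ b ∧ lowerWeight (1, a + 1 + b) = lowerWeight (1, a) + lowerWeight (0, b) + 4 := by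
  rw [lowerWeight_one (by omega), lowerWeight_zero]
  rcases eq_or_ne a 0 with rfl | ha
  · rw [lowerWeight_one_zero]; omega
  · rw [lowerWeight_one ha]; omega

/-- Toucher's replies in a position without long segments of which both ends are Isolator's. -/
theorem HasSegments.split_lowerWeight (h : HasSegments n T U M)
    (hM : ∀ c ∈ M, c.1 = 2 → c.2 = 0) {e : Sym2 (Fin (n + 1))} (he : e ∈ U) :
    ∃ M₂, HasSegments n (insert e T) (U.erase e) M₂ ∧ (∀ c ∈ M₂, c.1 = 2 → c.2 = 0) ∧
      ((M.map lowerWeight).sum ≤ (M₂.map lowerWeight).sum + 3 ∨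
        ∃ k M', 2 ≤ k ∧ M = (1, k + 1) ::ₘ M' ∧ M₂ = (1, 0) ::ₘ (0, k) ::ₘ M' ∧
          (M.map lowerWeight).sum ≤ (M₂.map lowerWeight).sum + 4) := by
  obtain ⟨l, r, a, b, M', hl, hr, rfl, h1, -⟩ := h.split he
  have h2 := hM _ (Multiset.mem_cons_self _ _)
  simp only at h2
  refine ⟨_, h1, ?_, ?_⟩
  · intro c hc
    rcases Multiset.mem_cons.1 hc with rfl | hc
    · intro h; simp only at h; omega
    rcases Multiset.mem_cons.1 hc with rfl | hc
    · intro h; simp only at h; omega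
    exact hM c (Multiset.mem_cons_of_mem hc)
  simp only [Multiset.map_cons, Multiset.sum_cons]
  obtain ⟨rfl, rfl⟩ | ⟨rfl, rfl⟩ | ⟨rfl, rfl⟩ :
    l = 0 ∧ r = 0 ∨ l = 1 ∧ r = 0 ∨ l = 0 ∧ r = 1 := by omega
  · left
    simp only [add_zero, lowerWeight_zero]
    omega
  · rcases lowerWeight_split_left a b with hw | ⟨rfl, hb, hw⟩
    · left; rw [add_zero]; omega
    · right
      refine ⟨b, M', hb, by rw [add_comm b], rfl, ?_⟩
      rw [add_zero]; omega
  · rw [show a + 1 + b = b + 1 + a by omega, zero_add]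
    rcases lowerWeight_split_left b a with hw | ⟨rfl, ha, hw⟩
    · left; omega
    · right
      refine ⟨a, M', ha, by rw [add_comm a], Multiset.cons_swap _ _ _, ?_⟩
      omega

/-- A lower bound for Toucher's turn follows from lower bounds after all her replies. -/
theorem HasSegments.le_toucherToMove (h : HasSegments n T U M) {K : ℕ}
    (hK : U = ∅ → K ≤ (M.map lowerWeight).sum)
    (hreply : ∀ e ∈ U, K ≤ 5 * isolatorToMove (insert e T) (U.erase e)) :
    K ≤ 5 * toucherToMove T U := by
  rcases U.eq_empty_or_nonempty with rfl | hU
  · rw [toucherToMove_empty]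
    have := h.sum_eq (f := lowerWeight) rfl rfl
    rw [lowerWeight_two] at this
    exact this ▸ hK rfl
  · have : (K + 4) / 5 ≤ toucherToMove T U :=
      ToucherIsolator.le_toucherToMove hU fun e he => by have := hreply e he; omega
    omega

/-- A segment `(2, 0)` has no edge left to claim, so it survives to the end. -/
theorem HasSegments.count_le (h : HasSegments n T U M) :
    M.count (2, 0) ≤ toucherToMove T U ∧ M.count (2, 0) ≤ isolatorToMove T U := by
  induction hN : #U using Nat.strong_induction_on generalizing T U M with
  | _ N ih =>
  subst hN
  rcases U.eq_empty_or_nonempty with rfl | ⟨e, he⟩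
  · rw [toucherToMove_empty, isolatorToMove_empty, h.untouched_eq]
    exact ⟨le_rfl, le_rfl⟩
  have hcount : ∀ {l r a b : ℕ} {M' : Multiset (ℕ × ℕ)} {c d : ℕ × ℕ},
      ((l + r, a + 1 + b) ::ₘ M').count (2, 0) ≤ (c ::ₘ d ::ₘ M').count (2, 0) := by
    intro l r a b M' c d
    rw [Multiset.count_cons_of_ne (fun h => by have := (Prod.mk.inj h).2; omega)]
    exact (Multiset.count_le_count_cons _ _ _).trans (Multiset.count_le_count_cons _ _ _)
  constructor
  · refine ToucherIsolator.le_toucherToMove ⟨e, he⟩ fun e he => ?_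
    obtain ⟨l, r, a, b, M', -, -, rfl, h1, -⟩ := h.split he
    exact hcount.trans (ih _ (card_erase_lt_of_mem he) h1 rfl).2
  · obtain ⟨l, r, a, b, M', -, -, rfl, -, h1⟩ := h.split he
    exact le_isolatorToMove he (hcount.trans (ih _ (card_erase_lt_of_mem he) h1 rfl).1)

theorem sum_lowerWeight_le (hM : ∀ c ∈ M, c.1 ≤ 2 ∧ (c.1 = 2 → c.2 = 0) ∧ (c.1 = 1 → c.2 = 0) ∧
    (c.1 = 0 → c.2 ≤ 2)) : (M.map lowerWeight).sum ≤ 5 * M.count (2, 0) := by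
  induction M using Multiset.induction with
  | empty => simp
  | cons c M ih =>
    rw [Multiset.map_cons, Multiset.sum_cons]
    have := ih fun d hd => hM d (Multiset.mem_cons_of_mem hd)
    obtain ⟨h1, h2, h3, h4⟩ := hM c (Multiset.mem_cons_self _ _)
    obtain ⟨i, k⟩ := c
    simp only at h1 h2 h3 h4
    interval_cases i
    · have := h4 rfl
      rw [Multiset.count_cons_of_ne (by simp), lowerWeight_zero]
      omega
    · obtain rfl := h3 rfl
      rw [Multiset.count_cons_of_ne (by simp), lowerWeight_one_zero]
      omega
    · obtain rfl := h2 rfl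
      rw [Multiset.count_cons_self, lowerWeight_two]
      omega

/-- The second claim is the bonus that repays a loss of 4 after a gain of only 3; both are proved in
one induction because the first uses it. -/
theorem HasSegments.lower_le (h : HasSegments n T U M) (hM : ∀ c ∈ M, c.1 = 2 → c.2 = 0) :
    (M.map lowerWeight).sum ≤ 5 * isolatorToMove T U ∧
      ∀ M', M = (1, 2) ::ₘ M' → (∀ c ∈ M', c.1 = 1 → c.2 = 0) →
        (M.map lowerWeight).sum + 1 ≤ 5 * isolatorToMove T U := by
  induction hN : #U using Nat.strong_induction_on generalizing T U M with
  | _ N ih =>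
  subst hN
  -- One round: a surplus of 3 pays for an ordinary reply. A reply costing 4 needs a surplus of 4 or
  -- must lead to a bonus position.
  have step : ∀ {e M₁ K}, e ∈ U → HasSegments n T (U.erase e) M₁ →
      (∀ c ∈ M₁, c.1 = 2 → c.2 = 0) → K + 3 ≤ (M₁.map lowerWeight).sum →
      (∀ k M', 2 ≤ k → M₁ = (1, k + 1) ::ₘ M' → K + 4 ≤ (M₁.map lowerWeight).sum ∨
        ∃ M'', (1, 0) ::ₘ (0, k) ::ₘ M' = (1, 2) ::ₘ M'' ∧ ∀ c ∈ M'', c.1 = 1 → c.2 = 0) →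
      K ≤ 5 * isolatorToMove T U := by
    intro e M₁ K he h₁ hM₁ hK hlong
    refine (h₁.le_toucherToMove (fun _ => by omega) fun e' he' => ?_).trans
      (Nat.mul_le_mul_left 5 (le_isolatorToMove he le_rfl))
    have hlt := (card_erase_lt_of_mem he').trans (card_erase_lt_of_mem he)
    obtain ⟨M₂, h₂, hM₂, hw | ⟨k, M', hk, e1, e2, hw⟩⟩ := h₁.split_lowerWeight hM₁ he'
    · have := (ih _ hlt h₂ hM₂ rfl).1
      omega
    · rcases hlong k M' hk e1 with h4 | ⟨M'', e3, hM''⟩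
      · have := (ih _ hlt h₂ hM₂ rfl).1
        omega
      · have := (ih _ hlt h₂ hM₂ rfl).2 M'' (e2.trans e3) hM''
        omega
  have hcons : ∀ {c d c' : ℕ × ℕ} {M' : Multiset (ℕ × ℕ)}, M = c' ::ₘ M' →
      (c.1 = 2 → c.2 = 0) → (d.1 = 2 → d.2 = 0) →
      ∀ x ∈ c ::ₘ d ::ₘ M', x.1 = 2 → x.2 = 0 := by
    rintro c d c' M' rfl hc hd x hx
    rcases Multiset.mem_cons.1 hx with rfl | hx
    · exact hc
    rcases Multiset.mem_cons.1 hx with rfl | hx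
    · exact hd
    exact hM x (Multiset.mem_cons_of_mem hx)
  constructor
  swap
  · rintro M' rfl hM'
    -- `(1, 2)` becomes `(2, 0)`, `(1, 1)`: a gain of 4, with no segment left on which Toucher can
    -- destroy 4.
    obtain ⟨e, he, -, h₁⟩ := h.exists_edge (l := 1) (r := 0) (a := 0) (b := 1) le_rfl (by omega)
    refine step he h₁ (hcons rfl (by simp) (by simp)) ?_ ?_
    · simp only [Multiset.map_cons, Multiset.sum_cons, Nat.reduceAdd, lowerWeight_two]
      rw [lowerWeight_one (by omega), lowerWeight_one (by omega)]
      omega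
    · intro k M'' hk hM''
      have hmem : (1, k + 1) ∈ (1 + 1, 0) ::ₘ (0 + 1, 1) ::ₘ M' := hM'' ▸ Multiset.mem_cons_self _ _
      simp only [Multiset.mem_cons, Prod.mk.injEq] at hmem
      rcases hmem with h | h | h
      · omega
      · omega
      · have := hM' _ h rfl
        simp at this
  by_cases hlong : ∃ k, 2 ≤ k ∧ (1, k) ∈ M
  · obtain ⟨k, hk, hmem⟩ := hlong
    obtain ⟨k, rfl⟩ : ∃ k', k = 0 + 1 + k' := ⟨k - 1, by omega⟩
    obtain ⟨M', rfl⟩ := Multiset.exists_cons_of_mem hmem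
    obtain ⟨e, he, -, h₁⟩ := h.exists_edge (l := 1) (r := 0) le_rfl (by omega)
    have hw : (((1, 0 + 1 + k) ::ₘ M').map lowerWeight).sum + 4 ≤
        (((1 + 1, 0) ::ₘ (0 + 1, k) ::ₘ M').map lowerWeight).sum := by
      simp only [Multiset.map_cons, Multiset.sum_cons, Nat.reduceAdd, lowerWeight_two]
      rw [lowerWeight_one (by omega), lowerWeight_one (by omega)]
      omega
    exact step he h₁ (hcons rfl (by simp) (by simp)) (by omega) fun _ _ _ _ => Or.inl hw
  push Not at hlong
  by_cases hone : (1, 1) ∈ M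
  · obtain ⟨M', rfl⟩ := Multiset.exists_cons_of_mem hone
    obtain ⟨e, he, -, h₁⟩ := h.exists_edge (l := 1) (r := 0) (a := 0) (b := 0) le_rfl (by omega)
    refine step he h₁ (hcons rfl (by simp) (by simp)) ?_ ?_
    · simp only [Multiset.map_cons, Multiset.sum_cons, Nat.reduceAdd, lowerWeight_two]
      rw [lowerWeight_one (by omega), lowerWeight_one_zero]
      omega
    · intro k M'' hk hM''
      have hmem : (1, k + 1) ∈ (1 + 1, 0) ::ₘ (0 + 1, 0) ::ₘ M' := hM'' ▸ Multiset.mem_cons_self _ _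
      simp only [Multiset.mem_cons, Prod.mk.injEq] at hmem
      rcases hmem with h | h | h
      · omega
      · omega
      · exact absurd (Multiset.mem_cons_of_mem h) (hlong (k + 1) (by omega))
  have hone' : ∀ c ∈ M, c.1 = 1 → c.2 = 0 := by
    rintro ⟨i, k⟩ hc hi
    obtain rfl : i = 1 := hi
    by_contra hk
    rcases eq_or_ne k 1 with rfl | hk1
    · exact hone hc
    · exact hlong k (by simp only at hk; omega) hc
  by_cases hzero : ∃ k, 3 ≤ k ∧ (0, k) ∈ M
  · obtain ⟨k, hk, hmem⟩ := hzero
    obtain ⟨M', rfl⟩ := Multiset.exists_cons_of_mem hmem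
    have hM' : ∀ c ∈ M', c.1 = 1 → c.2 = 0 := fun c hc => hone' c (Multiset.mem_cons_of_mem hc)
    rcases eq_or_ne k 3 with rfl | hk3
    · obtain ⟨e, he, -, h₁⟩ :=
        h.exists_edge (l := 0) (r := 0) (a := 1) (b := 1) (by omega) (by omega)
      refine step he h₁ (hcons rfl (by simp) (by simp)) ?_ ?_
      · simp only [Multiset.map_cons, Multiset.sum_cons, zero_add]
        rw [lowerWeight_zero, lowerWeight_one (by omega)]
        exact le_of_eq (by ring)
      · intro k M'' hk hM''
        have hmem : (1, k + 1) ∈ (0 + 1, 1) ::ₘ (0 + 1, 1) ::ₘ M' :=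
          hM'' ▸ Multiset.mem_cons_self _ _
        simp only [Multiset.mem_cons, Prod.mk.injEq] at hmem
        rcases hmem with h | h | h
        · omega
        · omega
        · have := hM' _ h rfl
          simp at this
    -- Splitting into `(1, 2)` and `(1, k)` gains 3. Toucher can destroy 4 only on `(1, k)`, which
    -- leaves `(1, 2)` as the bonus segment.
    · obtain ⟨k, rfl⟩ : ∃ k', k = 2 + 1 + k' := ⟨k - 3, by omega⟩
      obtain ⟨e, he, -, h₁⟩ :=
        h.exists_edge (l := 0) (r := 0) (a := 2) (b := k) (by omega) (by omega)
      refine step he h₁ (hcons rfl (by simp) (by simp)) ?_ ?_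
      · simp only [Multiset.map_cons, Multiset.sum_cons, zero_add]
        rw [lowerWeight_zero, lowerWeight_one (by omega), lowerWeight_one (by omega),
          show 2 + 1 + k - 2 = k + 1 by omega]
        exact le_of_eq (by ring)
      · intro j M'' hj hM''
        have hmem : (1, j + 1) ∈ (0 + 1, 2) ::ₘ (0 + 1, k) ::ₘ M' :=
          hM'' ▸ Multiset.mem_cons_self _ _
        simp only [Multiset.mem_cons, Prod.mk.injEq] at hmem
        rcases hmem with h | h | h
        · omega
        · obtain rfl : j + 1 = k := h.2
          rw [Multiset.cons_swap, zero_add, Multiset.cons_inj_right] at hM''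
          subst hM''
          refine Or.inr ⟨(1, 0) ::ₘ (0, j) ::ₘ M', ?_, ?_⟩
          · rw [Multiset.cons_swap (0, j), Multiset.cons_swap (1, 0)]
          · intro c hc
            rcases Multiset.mem_cons.1 hc with rfl | hc
            · simp
            rcases Multiset.mem_cons.1 hc with rfl | hc
            · simp
            exact hM' c hc
        · have := hM' _ h rfl
          simp at this
  push Not at hzero
  -- Now all the weight sits on segments `(2, 0)`, which are already secured.
  refine (sum_lowerWeight_le fun c hc => ⟨h.fst_le c hc, hM c hc, hone' c hc, fun hc0 => ?_⟩).trans
    (Nat.mul_le_mul_left 5 h.count_le.2)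
  by_contra hk
  obtain ⟨i, k⟩ := c
  obtain rfl : i = 0 := hc0
  exact hzero k (by simp only at hk; omega) hc

end Lower

-- Toucher's opening move and the value for paths

theorem u_pathGraph_le (hn : n ≠ 0) [DecidableRel (SimpleGraph.pathGraph (n + 1)).Adj] :
    u (SimpleGraph.pathGraph (n + 1)) ≤ (upperWeight (1, n - 1) + 1) / 2 := by
  have h := hasSegments_start (n := n)
  rw [u, edgeFinset_pathGraph]
  rw [show ({(2, n)} : Multiset (ℕ × ℕ)) = (1 + 1, 0 + 1 + (n - 1)) ::ₘ 0 by
    rw [show 0 + 1 + (n - 1) = n by omega]; rfl] at h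
  obtain ⟨e, he, h₁, -⟩ := h.exists_edge le_rfl le_rfl
  refine toucherToMove_le he (h₁.le_upper.2.trans ?_)
  simp [upperWeight_one_zero]

/-- Any opening leaves `(1, a)`, `(1, b)` with `a + b = n - 1`, of weight at least `n`; the minimum
is attained at an end edge. -/
theorem le_u_pathGraph (hn : 2 ≤ n) [DecidableRel (SimpleGraph.pathGraph (n + 1)).Adj] :
    n ≤ 5 * u (SimpleGraph.pathGraph (n + 1)) := by
  have h := hasSegments_start (n := n)
  rw [u, edgeFinset_pathGraph]
  suffices (n + 4) / 5 ≤ toucherToMove ∅ ((Icc 1 n).image (pathEdge n)) by omega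
  refine le_toucherToMove ((nonempty_Icc.2 (by omega)).image _) fun e he => ?_
  obtain ⟨l, r, a, b, M', hl, hr, hM, h₁, -⟩ := h.split he
  obtain ⟨h2, rfl⟩ := Multiset.cons_eq_cons.1 ((Multiset.cons_zero _).trans hM) |>.resolve_right
    fun ⟨_, cs, hcs, _⟩ => by simp at hcs
  obtain ⟨h3, h4⟩ := Prod.mk.inj h2
  obtain ⟨rfl, rfl⟩ : l = 1 ∧ r = 1 := by omega
  have hw := (h₁.lower_le (by simp)).1
  simp only [Multiset.map_cons, Multiset.sum_cons, Multiset.map_zero, Multiset.sum_zero] at hw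
  rcases eq_or_ne a 0 with rfl | ha <;> rcases eq_or_ne b 0 with rfl | hb
  · omega
  · rw [lowerWeight_one hb] at hw; omega
  · rw [lowerWeight_one ha] at hw; omega
  · rw [lowerWeight_one ha, lowerWeight_one hb] at hw; omega

end ToucherIsolator

theorem theorem2 (n : ℕ) [DecidableRel (SimpleGraph.pathGraph (n + 1)).Adj] :
    (2 ≤ n → ToucherIsolator.u (SimpleGraph.pathGraph (n + 1)) = (n + 4) / 5) ∧
      (n = 1 → ToucherIsolator.u (SimpleGraph.pathGraph (n + 1)) = 0) := by
  constructor
  · intro hn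
    have h1 := ToucherIsolator.u_pathGraph_le (n := n) (by omega)
    have h2 := ToucherIsolator.le_u_pathGraph hn
    rw [ToucherIsolator.upperWeight_one (by omega)] at h1
    omega
  · rintro rfl
    exact Nat.le_zero.1 (ToucherIsolator.u_pathGraph_le one_ne_zero)
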